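/- Given a finite digraph $D$, its competition graph $C(D)$ is the simple graph with the same vertex set as $D$ in which two distinct vertices $u,v$ are adjacent if and only if they have a common out-neighbor in $D$. A $k$-partite tournament is an orientation (each edge receives exactly one of its two directions) of a complete $k$-partite graph, all of whose $k$ partite sets are nonempty. Theorem. Let $k \ge 3$ be an integer. The complete graph $K_n$ on $n$ vertices is the competition graph of some $k$-partite tournament if and only if \[ \begin{cases} n \ge 13 & \text{if } k = 3;\\ n \ge 10 & \text{if } k = 4;\\ n \ge 9 & \text{if } k = 5;\\ n \ge 9 & \text{if } k = 6;\\ n \ge k & \text{if } k \ge 7. \end{cases} \] -/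

import Mathlib

/-- The competition graph `C(D)` of a digraph `D`: the simple graph on the vertex set of `D` in which
two distinct vertices are adjacent iff they have a common out-neighbor in `D`. -/
def competitionGraph {V : Type*} (D : Digraph V) : SimpleGraph V where
  Adj u v := u ≠ v ∧ ∃ w, D.Adj u w ∧ D.Adj v w
  symm := ⟨fun _ _ h => ⟨h.1.symm, h.2.imp fun _ hw => ⟨hw.2, hw.1⟩⟩⟩
  loopless := ⟨fun _ h => h.1 rfl⟩

/-- `D` is an orientation of the simple graph `G`: it has no loops and no directed 2-cycles
(asymmetry of `D.Adj` says both), and its underlying graph is `G`. -/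
def IsOrientation {V : Type*} (D : Digraph V) (G : SimpleGraph V) : Prop :=
  (∀ u v, D.Adj u v → ¬ D.Adj v u) ∧ D.toSimpleGraphInclusive = G

/-- `G` is a complete `k`-partite graph: its vertex set is split into `k` nonempty partite sets (the
fibers of `part`), and two vertices are adjacent iff they lie in different partite sets. -/
def IsCompletePartite {V : Type*} (k : ℕ) (G : SimpleGraph V) : Prop :=
  ∃ part : V → Fin k, Function.Surjective part ∧ ∀ u v, G.Adj u v ↔ part u ≠ part v

/-- A `k`-partite tournament is an orientation of a complete `k`-partite graph. -/
def IsPartiteTournament {V : Type*} (k : ℕ) (D : Digraph V) : Prop :=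
  ∃ G : SimpleGraph V, IsCompletePartite k G ∧ IsOrientation D G

/-! Replacing vertices by nonempty sets of twins preserves the property, so for fixed k the
admissible n form an up-set. It suffices to exhibit the least n and to refute its predecessor: 12
for k = 3, 9 for k = 4, 8 for k = 5, 6. For k ≥ 7 a seven-vertex tournament, with dominating
vertices added one at a time, attains the trivial bound n ≥ k.

The refutations rest on one remark: a vertex and any of its out-neighbors have a common
out-neighbor, so out-neighborhoods induce digraphs without sinks. Hence out-degrees are at least 3,
and a vertex of out-degree 3 dominates a directed triangle, which forces further vertices around it.
For k = 4, 5, 6 this local structure is played against a count of arcs. For k = 3 the same remark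
gives two out-neighbors in each other part; with 12 vertices all counts become equalities, and the
resulting 4+4+4 configuration is excluded by studying 2-subsets of a 4-set. -/

open Finset

/-- `R` is a multipartite tournament on `V` with partite sets the fibers of `p`, in which any two
distinct vertices have a common out-neighbor. -/
structure IsCompetitive {V ι : Type*} (R : V → V → Prop) (p : V → ι) : Prop where
  surj : Function.Surjective p
  asymm : ∀ u v, R u v → ¬ R v u
  adj_iff : ∀ u v, (R u v ∨ R v u) ↔ p u ≠ p v
  common : ∀ u v, u ≠ v → ∃ w, R u w ∧ R v w

theorem exists_digraph_iff_exists_isCompetitive {V : Type*} (k : ℕ) :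
    (∃ D : Digraph V, IsPartiteTournament k D ∧
        competitionGraph D = SimpleGraph.completeGraph V) ↔
      ∃ (R : V → V → Prop) (p : V → Fin k), IsCompetitive R p := by
  constructor
  · rintro ⟨D, ⟨G, ⟨p, hp, hG⟩, hasymm, hDG⟩, hC⟩
    refine ⟨D.Adj, p, hp, hasymm, fun u v => ?_, fun u v huv => ?_⟩
    · rw [← hG, ← hDG, Digraph.toSimpleGraphInclusive, SimpleGraph.fromRel_adj]
      refine ⟨fun h => ⟨?_, h⟩, fun h => h.2⟩
      rintro rfl
      rcases h with h | h <;> exact hasymm _ _ h h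
    · have h : (competitionGraph D).Adj u v := by
        rw [hC]; exact huv
      exact h.2
  · rintro ⟨R, p, h⟩
    refine ⟨⟨R⟩, ⟨Digraph.toSimpleGraphInclusive ⟨R⟩, ⟨p, h.surj, fun u v => ?_⟩, h.asymm, rfl⟩, ?_⟩
    · rw [Digraph.toSimpleGraphInclusive, SimpleGraph.fromRel_adj, ← h.adj_iff]
      refine ⟨fun h => h.2, fun h' => ⟨?_, h'⟩⟩
      rintro rfl
      rcases h' with h' | h' <;> exact h.asymm _ _ h' h'
    · ext u v
      exact ⟨fun h => h.1, fun huv => ⟨huv, h.common u v huv⟩⟩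

/-! ### Out-neighborhoods, twins and cones -/

namespace IsCompetitive

section Basic

variable {V ι : Type*} {R : V → V → Prop} {p : V → ι}

theorem ne (h : IsCompetitive R p) {u v : V} (huv : R u v) : u ≠ v := by
  rintro rfl
  exact h.asymm _ _ huv huv

theorem part_ne (h : IsCompetitive R p) {u v : V} (huv : R u v) : p u ≠ p v :=
  (h.adj_iff u v).1 (Or.inl huv)

theorem exists_out [Nontrivial ι] (h : IsCompetitive R p) (u : V) : ∃ v, R u v := by
  obtain ⟨i, hi⟩ := exists_ne (p u)
  obtain ⟨v, rfl⟩ := h.surj i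
  obtain ⟨w, hw, -⟩ := h.common u v (fun e => hi (by rw [e]))
  exact ⟨w, hw⟩

theorem exists_out_out (h : IsCompetitive R p) {u v : V} (huv : R u v) : ∃ w, R u w ∧ R v w :=
  h.common u v (h.ne huv)

theorem exists_out_path [Nontrivial ι] (h : IsCompetitive R p) {u : V} :
    ∃ x y z, R u x ∧ R u y ∧ R u z ∧ R x y ∧ R y z ∧ x ≠ z := by
  obtain ⟨x, hx⟩ := h.exists_out u
  obtain ⟨y, hy, hxy⟩ := h.exists_out_out hx
  obtain ⟨z, hz, hyz⟩ := h.exists_out_out hy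
  refine ⟨x, y, z, hx, hy, hz, hxy, hyz, ?_⟩
  rintro rfl
  exact h.asymm _ _ hxy hyz

/-- Replacing each vertex by a nonempty set of twins. -/
theorem comap [Nontrivial ι] (h : IsCompetitive R p) {W : Type*} {f : W → V}
    (hf : Function.Surjective f) : IsCompetitive (fun u v => R (f u) (f v)) (p ∘ f) where
  surj := h.surj.comp hf
  asymm _ _ := h.asymm _ _
  adj_iff _ _ := h.adj_iff _ _
  common u v _ := by
    by_cases huv : f u = f v
    · obtain ⟨w, hw⟩ := h.exists_out (f u)
      obtain ⟨w, rfl⟩ := hf w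
      exact ⟨w, hw, huv ▸ hw⟩
    · obtain ⟨w, hw⟩ := h.common _ _ huv
      obtain ⟨w, rfl⟩ := hf w
      exact ⟨w, hw⟩

end Basic

/-- Adding a vertex that dominates all others, in a partite set of its own. -/
theorem exists_cone {n k : ℕ} [Nontrivial (Fin k)] {R : Fin n → Fin n → Prop} {p : Fin n → Fin k}
    (h : IsCompetitive R p) :
    ∃ (S : Fin (n + 1) → Fin (n + 1) → Prop) (q : Fin (n + 1) → Fin (k + 1)),
      IsCompetitive S q := by
  refine ⟨fun u v => Fin.cases (Fin.cases False (fun _ => True) v)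
    (fun u => Fin.cases False (fun v => R u v) v) u,
    Fin.cases 0 (fun u => (p u).succ), ?_, ?_, ?_, ?_⟩
  · intro i
    cases i using Fin.cases with
    | zero => exact ⟨0, rfl⟩
    | succ i =>
      obtain ⟨v, rfl⟩ := h.surj i
      exact ⟨v.succ, rfl⟩
  · intro u v
    cases u using Fin.cases <;> cases v using Fin.cases <;> simp
    exact h.asymm _ _
  · intro u v
    cases u using Fin.cases <;> cases v using Fin.cases <;>
      simp [Fin.succ_ne_zero, (Fin.succ_ne_zero _).symm]
    exact h.adj_iff _ _
  · intro u v huv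
    cases u using Fin.cases with
    | zero =>
      cases v using Fin.cases with
      | zero => exact absurd rfl huv
      | succ v =>
        obtain ⟨w, hw⟩ := h.exists_out v
        exact ⟨w.succ, by simpa using hw⟩
    | succ u =>
      cases v using Fin.cases with
      | zero =>
        obtain ⟨w, hw⟩ := h.exists_out u
        exact ⟨w.succ, by simpa using hw⟩
      | succ v =>
        obtain ⟨w, hw⟩ := h.common u v (fun e => huv (by rw [e]))
        exact ⟨w.succ, by simpa using hw⟩

end IsCompetitive

theorem exists_isCompetitive_mono {k m n : ℕ} (hk : 2 ≤ k) (hmn : m ≤ n)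
    (h : ∃ (R : Fin m → Fin m → Prop) (p : Fin m → Fin k), IsCompetitive R p) :
    ∃ (R : Fin n → Fin n → Prop) (p : Fin n → Fin k), IsCompetitive R p := by
  obtain ⟨R, p, h⟩ := h
  have : Nontrivial (Fin k) := Fin.nontrivial_iff_two_le.2 hk
  obtain ⟨v, -⟩ := h.surj ⟨0, by omega⟩
  have : Nonempty (Fin m) := ⟨v⟩
  -- A left inverse of the inclusion of `Fin m` in `Fin n` is the surjection whose fibers are the
  -- twin classes.
  exact ⟨_, _, h.comap (Function.invFun_surjective (Fin.castLE_injective hmn))⟩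

/-! ### Extremal tournaments -/

section Constructions

/-- The digraph on `Fin n` in which the out-neighbors of `u` are the binary digits of the
`u`-th entry of a list. -/
def bitRel {n : ℕ} (l : List ℕ) (u v : Fin n) : Prop := (l.getD u 0).testBit v = true

instance {n : ℕ} (l : List ℕ) (u v : Fin n) : Decidable (bitRel l u v) :=
  inferInstanceAs (Decidable (_ = true))

theorem exists_isCompetitive_of_bitRel {n k : ℕ} (l : List ℕ) (p : Fin n → Fin k)
    (h₁ : ∀ i, ∃ v, p v = i) (h₂ : ∀ u v : Fin n, bitRel l u v → ¬ bitRel l v u)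
    (h₃ : ∀ u v : Fin n, (bitRel l u v ∨ bitRel l v u) ↔ p u ≠ p v)
    (h₄ : ∀ u v : Fin n, u ≠ v → ∃ w : Fin n, bitRel l u w ∧ bitRel l v w) :
    ∃ (R : Fin n → Fin n → Prop) (p : Fin n → Fin k), IsCompetitive R p :=
  ⟨_, p, h₁, h₂, h₃, h₄⟩

theorem exists_isCompetitive_three_thirteen :
    ∃ (R : Fin 13 → Fin 13 → Prop) (p : Fin 13 → Fin 3), IsCompetitive R p :=
  exists_isCompetitive_of_bitRel
    [3456, 4896, 3168, 2752, 5312, 1561, 6147, 1542, 6172, 341, 330, 178, 173]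
    ![0, 0, 0, 0, 0, 1, 1, 1, 1, 2, 2, 2, 2]
    (by decide +kernel) (by decide +kernel) (by decide +kernel) (by decide +kernel)

theorem exists_isCompetitive_four_ten :
    ∃ (R : Fin 10 → Fin 10 → Prop) (p : Fin 10 → Fin 4), IsCompetitive R p :=
  exists_isCompetitive_of_bitRel [608, 336, 416, 656, 773, 778, 60, 51, 201, 198]
    ![0, 0, 0, 0, 1, 1, 2, 2, 3, 3]
    (by decide +kernel) (by decide +kernel) (by decide +kernel) (by decide +kernel)

theorem exists_isCompetitive_five_nine :
    ∃ (R : Fin 9 → Fin 9 → Prop) (p : Fin 9 → Fin 5), IsCompetitive R p :=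
  exists_isCompetitive_of_bitRel [228, 216, 322, 385, 77, 142, 296, 276, 51]
    ![0, 0, 1, 1, 2, 2, 3, 3, 4]
    (by decide +kernel) (by decide +kernel) (by decide +kernel) (by decide +kernel)

theorem exists_isCompetitive_six_nine :
    ∃ (R : Fin 9 → Fin 9 → Prop) (p : Fin 9 → Fin 6), IsCompetitive R p :=
  exists_isCompetitive_of_bitRel [60, 420, 336, 482, 202, 388, 291, 69, 145]
    ![0, 0, 1, 1, 2, 2, 3, 4, 5]
    (by decide +kernel) (by decide +kernel) (by decide +kernel) (by decide +kernel)

/-- The seven out-neighborhoods are the lines of a Fano plane, and any two lines meet. -/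
theorem exists_isCompetitive_seven_seven :
    ∃ (R : Fin 7 → Fin 7 → Prop) (p : Fin 7 → Fin 7), IsCompetitive R p :=
  exists_isCompetitive_of_bitRel [14, 52, 104, 82, 69, 25, 35] id
    (by decide +kernel) (by decide +kernel) (by decide +kernel) (by decide +kernel)

theorem exists_isCompetitive_self {k : ℕ} (hk : 7 ≤ k) :
    ∃ (R : Fin k → Fin k → Prop) (p : Fin k → Fin k), IsCompetitive R p := by
  induction k, hk using Nat.le_induction with
  | base => exact exists_isCompetitive_seven_seven
  | succ k hk ih =>
    obtain ⟨R, p, h⟩ := ih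
    have : Nontrivial (Fin k) := Fin.nontrivial_iff_two_le.2 (by omega)
    exact h.exists_cone

end Constructions

/-! ### Arc counting and vertices of out-degree three -/

namespace IsCompetitive

section Counting

open Classical in
/-- The out-degree of a vertex. -/
noncomputable def outdeg {V : Type*} [Fintype V] (R : V → V → Prop) (u : V) : ℕ :=
  #{v | R u v}

open Classical in
/-- The size of a partite set. -/
noncomputable def size {V ι : Type*} [Fintype V] (p : V → ι) (i : ι) : ℕ :=
  #{v | p v = i}

variable {V ι : Type*} [Fintype V] {R : V → V → Prop} {p : V → ι}

theorem size_eq (p : V → ι) (i : ι) [DecidablePred fun v => p v = i] :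
    size p i = #{v | p v = i} := by
  unfold size
  congr

theorem sum_size [Fintype ι] (p : V → ι) : ∑ i, size p i = Fintype.card V := by
  classical
  rw [← Finset.card_univ, Finset.card_eq_sum_card_fiberwise (f := p) (t := univ) (by simp)]
  simp [size]

/-- Each ordered pair of vertices is an arc, a reversed arc, or lies inside one part. -/
theorem two_mul_sum_outdeg_add [Fintype ι] (h : IsCompetitive R p) :
    2 * ∑ u, outdeg R u + ∑ i, size p i ^ 2 = Fintype.card V ^ 2 := by
  classical
  have h1 : ∑ i, size p i ^ 2 = ∑ u : V, ∑ v : V, if p v = p u then 1 else 0 := by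
    rw [← Finset.sum_fiberwise (s := univ) (g := p)]
    refine Finset.sum_congr rfl fun i _ => ?_
    rw [Finset.sum_congr rfl (g := fun _ => size p i)]
    · simp [size, sq]
    · intro u hu
      simp only [Finset.mem_filter] at hu
      simp [size, hu.2]
  have h2 : ∑ u, outdeg R u = ∑ u : V, ∑ v : V, if R u v then 1 else 0 := by
    simp [outdeg]
  have h3 : ∑ u, outdeg R u = ∑ u : V, ∑ v : V, if R v u then 1 else 0 := by
    rw [h2, Finset.sum_comm]
  rw [two_mul]
  nth_rewrite 1 [h2]
  rw [h3, h1, ← Finset.sum_add_distrib, ← Finset.sum_add_distrib]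
  have : ∀ u : V, (((∑ v : V, if R u v then 1 else 0) + ∑ v : V, if R v u then 1 else 0) +
      ∑ v : V, if p v = p u then 1 else 0) = Fintype.card V := by
    intro u
    rw [← Finset.sum_add_distrib, ← Finset.sum_add_distrib, ← Finset.card_univ,
      Finset.card_eq_sum_ones]
    refine Finset.sum_congr rfl fun v _ => ?_
    have ha := h.asymm u v
    have hb := h.adj_iff u v
    by_cases h1 : R u v <;> by_cases h2 : R v u <;> by_cases h3 : p v = p u <;> simp_all
  rw [Finset.sum_congr rfl fun u _ => this u]
  simp [sq]

theorem eq_of_outdeg_eq_three {u x y z : V} (hu : outdeg R u = 3) (hx : R u x) (hy : R u y)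
    (hz : R u z) (hxy : x ≠ y) (hyz : y ≠ z) (hxz : x ≠ z) {v : V} (hv : R u v) :
    v = x ∨ v = y ∨ v = z := by
  classical
  have : ({x, y, z} : Finset V) = ({v | R u v} : Finset V) := by
    apply Finset.eq_of_subset_of_card_le
    · intro w hw
      simp only [Finset.mem_insert, Finset.mem_singleton] at hw
      rcases hw with rfl | rfl | rfl <;> simpa
    · rw [Finset.card_eq_three.2 ⟨x, y, z, hxy, hxz, hyz, rfl⟩]
      unfold outdeg at hu
      convert hu.le
  have hv' : v ∈ ({x, y, z} : Finset V) := by rw [this]; simpa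
  simpa using hv'

theorem three_le_outdeg [Nontrivial ι] (h : IsCompetitive R p) (u : V) : 3 ≤ outdeg R u := by
  classical
  obtain ⟨x, y, z, hx, hy, hz, hxy, hyz, hxz⟩ := h.exists_out_path (u := u)
  rw [← Finset.card_eq_three.2 ⟨x, y, z, h.ne hxy, hxz, h.ne hyz, rfl⟩]
  apply Finset.card_le_card
  intro w hw
  simp only [Finset.mem_insert, Finset.mem_singleton] at hw
  rcases hw with rfl | rfl | rfl <;> simpa

/-- The out-neighborhood has no sink, so it is a directed triangle. A common out-neighbor `a` of `y`
and `z` must share an out-neighbor with `u`, and only `x` is left; `b` and `c` arise by rotation. -/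
theorem exists_of_outdeg_eq_three [Nontrivial ι] (h : IsCompetitive R p) {u : V}
    (hu : outdeg R u = 3) :
    ∃ x y z a b c, R u x ∧ R u y ∧ R u z ∧ R x y ∧ R y z ∧ R z x ∧
      R a x ∧ R y a ∧ R z a ∧ R b y ∧ R z b ∧ R x b ∧ R c z ∧ R x c ∧ R y c := by
  obtain ⟨x, y, z, hx, hy, hz, hxy, hyz, hxz⟩ := h.exists_out_path (u := u)
  have key := fun {v} => eq_of_outdeg_eq_three hu hx hy hz (h.ne hxy) (h.ne hyz) hxz (v := v)
  have hzx : R z x := by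
    obtain ⟨w, hw, hzw⟩ := h.exists_out_out hz
    rcases key hw with rfl | rfl | rfl
    · exact hzw
    · exact absurd hzw (h.asymm _ _ hyz)
    · exact absurd hzw (h.asymm _ _ hzw)
  have third : ∀ x y z, R u y → R y z → (∀ v, R u v → v = x ∨ v = y ∨ v = z) →
      ∃ a, R a x ∧ R y a ∧ R z a := by
    intro x y z hy hyz key
    obtain ⟨a, hya, hza⟩ := h.common y z (h.ne hyz)
    have hau : a ≠ u := by
      rintro rfl
      exact h.asymm _ _ hy hya
    obtain ⟨w, haw, hw⟩ := h.common a u hau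
    rcases key w hw with rfl | rfl | rfl
    · exact ⟨a, haw, hya, hza⟩
    · exact absurd haw (h.asymm _ _ hya)
    · exact absurd haw (h.asymm _ _ hza)
  obtain ⟨a, ha, hya, hza⟩ := third x y z hy hyz fun v hv => key hv
  obtain ⟨b, hb, hzb, hxb⟩ := third y z x hz hzx fun v hv => by have := key hv; tauto
  obtain ⟨c, hc, hxc, hyc⟩ := third z x y hx hxy fun v hv => by have := key hv; tauto
  exact ⟨x, y, z, a, b, c, hx, hy, hz, hxy, hyz, hzx, ha, hya, hza, hb, hzb, hxb, hc, hxc, hyc⟩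

end Counting

end IsCompetitive

/-! ### Nine vertices in four parts; eight vertices in at most six parts -/

namespace IsCompetitive

section Nonexistence

variable {V ι : Type*} [Fintype V] {R : V → V → Prop} {p : V → ι}

theorem size_pos (h : IsCompetitive R p) (i : ι) : 1 ≤ size p i := by
  classical
  obtain ⟨v, rfl⟩ := h.surj i
  exact Finset.card_pos.2 ⟨v, by simp⟩

theorem four_mul_card_le [Nontrivial ι] (h : IsCompetitive R p) :
    4 * Fintype.card V ≤ ∑ u, outdeg R u + #{u | outdeg R u = 3} := by
  classical
  rw [Finset.card_filter, ← Finset.sum_add_distrib, ← Finset.card_univ, mul_comm, ← smul_eq_mul,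
    ← Finset.sum_const]
  refine Finset.sum_le_sum fun u _ => ?_
  have := h.three_le_outdeg u
  split_ifs <;> omega

theorem _root_.Fin.eq_of_ne_of_ne_of_ne {i j k l m : Fin 4} (hij : i ≠ j) (hik : i ≠ k)
    (hil : i ≠ l) (hjk : j ≠ k) (hjl : j ≠ l) (hkl : k ≠ l) (hj : m ≠ j) (hk : m ≠ k)
    (hl : m ≠ l) : m = i := by
  omega

/-- The triangle `x`, `y`, `z` occupies the three parts other than that of `u`, and each of `a`,
`b`, `c` is adjacent to all of it, so all three fall into the part of `u`. -/
theorem four_le_size {p : V → Fin 4} (h : IsCompetitive R p) {u : V} (hu : outdeg R u = 3) :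
    4 ≤ size p (p u) := by
  classical
  obtain ⟨x, y, z, a, b, c, hx, hy, hz, hxy, hyz, hzx, ha, hya, hza, hb, hzb, hxb, hc, hxc, hyc⟩ :=
    h.exists_of_outdeg_eq_three hu
  have hpa : p a = p u := Fin.eq_of_ne_of_ne_of_ne (h.part_ne hx) (h.part_ne hy) (h.part_ne hz)
    (h.part_ne hxy) (h.part_ne hzx).symm (h.part_ne hyz) (h.part_ne ha) (h.part_ne hya).symm (h.part_ne hza).symm
  have hpb : p b = p u := Fin.eq_of_ne_of_ne_of_ne (h.part_ne hx) (h.part_ne hy) (h.part_ne hz)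
    (h.part_ne hxy) (h.part_ne hzx).symm (h.part_ne hyz) (h.part_ne hxb).symm (h.part_ne hb) (h.part_ne hzb).symm
  have hpc : p c = p u := Fin.eq_of_ne_of_ne_of_ne (h.part_ne hx) (h.part_ne hy) (h.part_ne hz)
    (h.part_ne hxy) (h.part_ne hzx).symm (h.part_ne hyz) (h.part_ne hxc).symm (h.part_ne hyc).symm (h.part_ne hc)
  have hasymm := h.asymm
  have hnd : #{u, a, b, c} = 4 := by
    have hab : a ≠ b := by grind
    have hbc : b ≠ c := by grind
    have hac : a ≠ c := by grind
    have hu : u ∉ ({a, b, c} : Finset V) := by grind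
    rw [Finset.card_insert_of_notMem hu, Finset.card_eq_three.2 ⟨a, b, c, hab, hac, hbc, rfl⟩]
  refine hnd.ge.trans (Finset.card_le_card ?_)
  intro v hv
  simp only [Finset.mem_insert, Finset.mem_singleton] at hv
  rcases hv with rfl | rfl | rfl | rfl <;> simp [*]

theorem card_ne_nine {p : V → Fin 4} (h : IsCompetitive R p) : Fintype.card V ≠ 9 := by
  classical
  intro hV
  have h1 := h.two_mul_sum_outdeg_add
  have h2 := sum_size p
  have h3 := h.four_mul_card_le
  rw [hV] at h1 h2 h3
  -- This is (s - 1)(s - 2) ≥ 0.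
  have hsq : ∀ i, 3 * size p i ≤ size p i ^ 2 + 2 := fun i => by
    have := h.size_pos i
    generalize size p i = s at *
    rcases s with _ | _ | s
    · omega
    · omega
    · nlinarith
  have hpos := h.size_pos
  obtain ⟨u, hu⟩ : ∃ u, outdeg R u = 3 := by
    by_contra! hu
    rw [Finset.filter_false_of_mem fun u _ => hu u] at h3
    simp only [Fin.sum_univ_four, Finset.card_empty] at *
    have := hsq 0
    have := hsq 1
    have := hsq 2
    have := hsq 3
    omega
  -- Two parts of size at least 4 and two nonempty ones would need ten vertices.
  have hsmall : ∀ v, outdeg R v = 3 → p v = p u := by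
    intro v hv
    have hu' := h.four_le_size hu
    have hv' := h.four_le_size hv
    by_contra hne
    generalize p u = i at *
    generalize p v = j at *
    rw [Fin.sum_univ_four] at h2
    have := hpos 0
    have := hpos 1
    have := hpos 2
    have := hpos 3
    fin_cases i <;> fin_cases j <;> simp at * <;> omega
  have hle : #{v | outdeg R v = 3} ≤ size p (p u) := by
    apply Finset.card_le_card
    intro v hv
    simp only [Finset.mem_filter, Finset.mem_univ, true_and] at hv ⊢
    exact hsmall v hv
  -- With s the size of the part of `u`, the out-degrees sum to at least 36 - s and the other three
  -- squares to at least 3(9 - s) - 6. The outcome s² - 5s + 12 ≤ 0 has negative discriminant.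
  have hfin : 2 * (36 - (size p (p u) : ℤ)) + 21 +
      (size p (p u) : ℤ) ^ 2 - 3 * size p (p u) ≤ 81 := by
    generalize p u = i at *
    rw [Fin.sum_univ_four] at h1 h2
    have := hsq 0
    have := hsq 1
    have := hsq 2
    have := hsq 3
    zify at *
    fin_cases i <;> simp at * <;> linarith
  nlinarith [sq_nonneg (2 * (size p (p u) : ℤ) - 5)]

/-- Eight vertices, with `x, y, z, a, b, c` pairwise adjacent, leave no room for `u` to be a
non-neighbor of `a`. -/
theorem false_of_part_eq [Fintype ι] (h : IsCompetitive R p) (hV : Fintype.card V = 8)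
    (hι : Fintype.card ι ≤ 6) {u x y z a b c : V}
    (hx : R u x) (hy : R u y) (hz : R u z) (hxy : R x y) (hyz : R y z) (hzx : R z x)
    (ha : R a x) (hya : R y a) (hza : R z a) (hb : R b y) (hzb : R z b) (hxb : R x b)
    (hc : R c z) (hxc : R x c) (hyc : R y c) (hcb : R c b) (hac : R a c) (hba : R b a)
    (hX : ∀ v, R x v → v = y ∨ v = b ∨ v = c) (hY : ∀ v, R y v → v = z ∨ v = c ∨ v = a)
    (hZ : ∀ v, R z v → v = x ∨ v = a ∨ v = b) (hu : p u = p a) : False := by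
  classical
  have hasymm := h.asymm
  have hub : ¬ R a u := fun e => h.part_ne e hu.symm
  obtain ⟨t, hat, hbt⟩ := h.common a b (h.ne hba).symm
  obtain ⟨s, has, hcs⟩ := h.common a c (h.ne hac)
  -- Both `t` and `s` lie outside the seven named vertices, and only one further vertex exists.
  have hts : t = s := by
    by_contra hts
    have hnd : [u, x, y, z, a, b, c, s, t].Nodup := by
      clear hX hY hZ hu hV hι
      simp only [List.nodup_cons, List.mem_cons, List.not_mem_nil, or_false, not_or,
        not_false_eq_true, List.nodup_nil, and_true]
      and_intros <;> grind
    have := hnd.length_le_card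
    simp [hV] at this
  subst hts
  have hty : R t y := by
    have hne : t ≠ x := by rintro rfl; exact hasymm _ _ hbt hxb
    obtain ⟨w, hw, htw⟩ := h.common x t hne.symm
    rcases hX w hw with rfl | rfl | rfl
    · exact htw
    · exact absurd htw (hasymm _ _ hbt)
    · exact absurd htw (hasymm _ _ hcs)
  have htz : R t z := by
    have hne : t ≠ y := by rintro rfl; exact hasymm _ _ hat hya
    obtain ⟨w, hw, htw⟩ := h.common y t hne.symm
    rcases hY w hw with rfl | rfl | rfl
    · exact htw
    · exact absurd htw (hasymm _ _ hcs)
    · exact absurd htw (hasymm _ _ hat)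
  have htx : R t x := by
    have hne : t ≠ z := by rintro rfl; exact hasymm _ _ hat hza
    obtain ⟨w, hw, htw⟩ := h.common z t hne.symm
    rcases hZ w hw with rfl | rfl | rfl
    · exact htw
    · exact absurd htw (hasymm _ _ hat)
    · exact absurd htw (hasymm _ _ hbt)
  -- Seven pairwise adjacent vertices need seven parts.
  have hnd : [p x, p y, p z, p a, p b, p c, p t].Nodup := by
    have hp := fun v w => h.part_ne (u := v) (v := w)
    clear hX hY hZ hu hV hι
    simp only [List.nodup_cons, List.mem_cons, List.not_mem_nil, or_false, not_or,
      not_false_eq_true, List.nodup_nil, and_true]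
    and_intros <;> grind
  have := hnd.length_le_card
  simp at this
  omega

/-- Otherwise `x`, `y`, `z` also dominate directed triangles, which makes `x`, `y`, `z`, `a`, `b`,
`c` pairwise adjacent. With at most six parts, `u` then shares a part with `a`, `b` or `c`, and the
three cases are rotations of one another. -/
theorem exists_four_le_outdeg [Fintype ι] [Nontrivial ι] (h : IsCompetitive R p)
    (hV : Fintype.card V = 8) (hι : Fintype.card ι ≤ 6) {u : V} (hu : outdeg R u = 3) :
    ∃ v, R u v ∧ outdeg R v ≠ 3 := by
  by_contra! hall
  obtain ⟨x, y, z, a, b, c, hx, hy, hz, hxy, hyz, hzx, ha, hya, hza, hb, hzb, hxb, hc, hxc, hyc⟩ :=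
    h.exists_of_outdeg_eq_three hu
  have hasymm := h.asymm
  have hX : ∀ v, R x v → v = y ∨ v = b ∨ v = c := fun v => eq_of_outdeg_eq_three (hall x hx)
    hxy hxb hxc (h.ne hb).symm (by grind) (h.ne hyc)
  have hY : ∀ v, R y v → v = z ∨ v = c ∨ v = a := fun v => eq_of_outdeg_eq_three (hall y hy)
    hyz hyc hya (h.ne hc).symm (by grind) (h.ne hza)
  have hZ : ∀ v, R z v → v = x ∨ v = a ∨ v = b := fun v => eq_of_outdeg_eq_three (hall z hz)
    hzx hza hzb (h.ne ha).symm (by grind) (h.ne hxb)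
  have hcb : R c b := by
    obtain ⟨w, hw, hcw⟩ := h.exists_out_out hxc
    rcases hX w hw with rfl | rfl | rfl
    · exact absurd hcw (hasymm _ _ hyc)
    · exact hcw
    · exact absurd hcw (hasymm _ _ hcw)
  have hac : R a c := by
    obtain ⟨w, hw, haw⟩ := h.exists_out_out hya
    rcases hY w hw with rfl | rfl | rfl
    · exact absurd haw (hasymm _ _ hza)
    · exact haw
    · exact absurd haw (hasymm _ _ haw)
  have hba : R b a := by
    obtain ⟨w, hw, hbw⟩ := h.exists_out_out hzb
    rcases hZ w hw with rfl | rfl | rfl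
    · exact absurd hbw (hasymm _ _ hxb)
    · exact hbw
    · exact absurd hbw (hasymm _ _ hbw)
  have hp := fun v w => h.part_ne (u := v) (v := w)
  have hpu : p u = p a ∨ p u = p b ∨ p u = p c := by
    by_contra! hne
    have hnd : [p x, p y, p z, p a, p b, p c, p u].Nodup := by
      clear hX hY hZ hV hι
      simp only [List.nodup_cons, List.mem_cons, List.not_mem_nil, or_false, not_or,
        not_false_eq_true, List.nodup_nil, and_true]
      and_intros <;> grind
    have := hnd.length_le_card
    simp at this
    omega
  rcases hpu with e | e | e
  · exact h.false_of_part_eq hV hι hx hy hz hxy hyz hzx ha hya hza hb hzb hxb hc hxc hyc hcb hac hba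
      hX hY hZ e
  · exact h.false_of_part_eq hV hι hy hz hx hyz hzx hxy hb hzb hxb hc hxc hyc ha hya hza hac hba hcb
      hY hZ hX e
  · exact h.false_of_part_eq hV hι hz hx hy hzx hxy hyz hc hxc hyc ha hya hza hb hzb hxb hba hcb hac
      hZ hX hY e

theorem card_ne_eight [Fintype ι] [Nontrivial ι] (h : IsCompetitive R p)
    (hι : Fintype.card ι ≤ 6) : Fintype.card V ≠ 8 := by
  classical
  intro hV
  have h1 := h.two_mul_sum_outdeg_add
  have h2 := sum_size p
  rw [hV] at h1 h2
  have hsq : 3 * ∑ i, size p i ≤ ∑ i, size p i ^ 2 + ∑ i : ι, 2 := by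
    rw [Finset.mul_sum, ← Finset.sum_add_distrib]
    refine Finset.sum_le_sum fun i _ => ?_
    have := h.size_pos i
    generalize size p i = s at *
    rcases s with _ | _ | s
    · omega
    · omega
    · nlinarith
  simp only [Finset.sum_const, Finset.card_univ, smul_eq_mul] at hsq
  set B : Finset V := {v | outdeg R v ≠ 3} with hB
  have hsum : ∑ u, outdeg R u = ∑ _u : V, 3 + ∑ u ∈ B, (outdeg R u - 3) := by
    rw [hB, Finset.sum_filter (fun u => outdeg R u ≠ 3) (fun u => outdeg R u - 3),
      ← Finset.sum_add_distrib]
    refine Finset.sum_congr rfl fun u _ => ?_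
    have := h.three_le_outdeg u
    split_ifs <;> omega
  have hBle : #B ≤ ∑ u ∈ B, (outdeg R u - 3) := by
    rw [Finset.card_eq_sum_ones]
    refine Finset.sum_le_sum fun u hu => ?_
    have := h.three_le_outdeg u
    simp [hB] at hu
    omega
  simp only [Finset.sum_const, Finset.card_univ, smul_eq_mul, hV] at hsum
  have hdom : ∀ u, u ∉ B → ∃ v ∈ B, R u v := by
    intro u hu
    obtain ⟨v, hv, hv'⟩ := h.exists_four_le_outdeg hV hι (u := u) (by simpa [hB] using hu)
    exact ⟨v, by simpa [hB] using hv', hv⟩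
  have hdeg : ∀ u ∈ B, 4 ≤ outdeg R u := by
    intro u hu
    have := h.three_le_outdeg u
    simp [hB] at hu
    omega
  have hcompl : #Bᶜ + #B = 8 := by rw [← hV, Finset.card_compl_add_card]
  have hsplit : ∀ u, #{v ∈ Bᶜ | R u v} + #{v ∈ B | R u v} = outdeg R u := by
    intro u
    rw [← Finset.card_union_of_disjoint, ← Finset.filter_union]
    · rw [Finset.union_comm, Finset.union_compl, outdeg]
    · exact Finset.disjoint_filter_filter disjoint_compl_left
  have hinout : ∀ u, #{v ∈ Bᶜ | R u v} + #{v ∈ Bᶜ | R v u} ≤ #Bᶜ := by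
    intro u
    rw [← Finset.card_union_of_disjoint]
    · exact Finset.card_le_card (by grind)
    · exact Finset.disjoint_filter.2 fun v _ => h.asymm u v
  have hcover : #Bᶜ ≤ ∑ u ∈ B, #{v ∈ Bᶜ | R v u} := by
    refine (Finset.card_le_card ?_).trans Finset.card_biUnion_le
    intro v hv
    obtain ⟨w, hw, hvw⟩ := hdom v (by simpa using hv)
    simp only [Finset.mem_biUnion, Finset.mem_filter]
    exact ⟨w, hw, hv, hvw⟩
  -- The squares sum to at least 24 - 12, so the out-degrees sum to at most 26, only 2 above the
  -- minimum 24.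
  obtain hc | hc | hc : #B = 0 ∨ #B = 1 ∨ #B = 2 := by omega
  · rw [Finset.card_eq_zero] at hc
    simp [hc, hV] at hcover
  · obtain ⟨q, hq⟩ := Finset.card_eq_one.1 hc
    have e1 := hsplit q
    have e2 := hinout q
    have e3 := hdeg q (by simp [hq])
    have e4 : #{v ∈ B | R q v} ≤ #B := Finset.card_filter_le _ _
    have e5 : #{v ∈ B | R q v} = 0 := by
      rw [hq, Finset.card_eq_zero, Finset.filter_eq_empty_iff]
      intro v hv hqv
      exact h.ne hqv (Finset.mem_singleton.1 hv).symm
    rw [hq, Finset.sum_singleton, ← hq] at hcover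
    omega
  -- Of the twelve pairs between `B` and its complement at least six are arcs into `B`. So `q` and
  -- `r` have total out-degree at most 6 + 1, but need 8.
  · obtain ⟨q, r, hqr, hq⟩ := Finset.card_eq_two.1 hc
    have e1 := hsplit q
    have e2 := hinout q
    have e3 := hdeg q (by simp [hq])
    have f1 := hsplit r
    have f2 := hinout r
    have f3 := hdeg r (by simp [hq])
    have e5 : #{v ∈ B | R q v} + #{v ∈ B | R r v} ≤ 1 := by
      have hqq : ¬ R q q := fun e => h.ne e rfl
      have hrr : ¬ R r r := fun e => h.ne e rfl
      have := h.asymm q r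
      rw [hq, Finset.filter_insert, Finset.filter_insert, Finset.filter_singleton,
        Finset.filter_singleton]
      by_cases hqr' : R q r <;> by_cases hrq : R r q <;> simp_all
    rw [hq, Finset.sum_pair hqr, ← hq] at hcover
    omega

end Nonexistence
end IsCompetitive

/-! ### The balanced tripartite case -/

section Tripartite

/-- For X = {1, 2} and X' = {1, 3}, only {1, 4} and {2, 3} meet both in one point, and these are
disjoint. -/
theorem Fin.subset_of_card_inter_eq_one {X X' Y Y' : Finset (Fin 4)} (hX : #X = 2) (hX' : #X' = 2)
    (hY : #Y = 2) (hY' : #Y' = 2) (h₁ : #(X ∩ Y) = 1) (h₂ : #(X ∩ Y') = 1) (h₃ : #(X' ∩ Y) = 1)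
    (h₄ : #(X' ∩ Y') = 1) (hne : (X ∩ X').Nonempty) (hsub : ¬ X ⊆ X')
    (hne' : (Y ∩ Y').Nonempty) : Y ⊆ Y' := by
  have key : ∀ X ∈ powersetCard 2 (univ : Finset (Fin 4)), ∀ X' ∈ powersetCard 2 univ,
      (X ∩ X').Nonempty → ¬ X ⊆ X' →
      ∀ Y ∈ powersetCard 2 univ, #(X ∩ Y) = 1 → #(X' ∩ Y) = 1 →
      ∀ Y' ∈ powersetCard 2 univ, #(X ∩ Y') = 1 → #(X' ∩ Y') = 1 →
      (Y ∩ Y').Nonempty → Y ⊆ Y' := by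
    decide +kernel
  simp only [Finset.mem_powersetCard_univ] at key
  exact key X hX X' hX' hne hsub Y hY h₁ h₃ Y' hY' h₂ h₄ hne'

theorem Fin.inter_nonempty_of_notMem {X X' : Finset (Fin 4)} (hX : #X = 2) (hX' : #X' = 2)
    {b : Fin 4} (hb : b ∉ X) (hb' : b ∉ X') : (X ∩ X').Nonempty := by
  have key : ∀ X ∈ powersetCard 2 (univ : Finset (Fin 4)), ∀ X' ∈ powersetCard 2 univ, ∀ b,
      b ∉ X → b ∉ X' → (X ∩ X').Nonempty := by
    decide +kernel
  simp only [Finset.mem_powersetCard_univ] at key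
  exact key X hX X' hX' b hb hb'

/-- The rows of a relation are pairwise equal or disjoint. -/
def IsBlockRel {α β : Type*} (S : α → β → Prop) : Prop :=
  ∀ a a' c c', S a c → S a' c → S a c' → S a' c'

/-- There is no orientation of the complete tripartite graph with parts of size four in which
every vertex dominates exactly two vertices of each other part and any two vertices have a common
out-neighbor. -/
theorem not_exists_balanced_tripartite (Q : Fin 3 → Fin 3 → Fin 4 → Fin 4 → Prop)
    [∀ i j a b, Decidable (Q i j a b)]
    (hQ : ∀ i j a b, i ≠ j → (Q i j a b ↔ ¬ Q j i b a))
    (hdeg : ∀ i j a, i ≠ j → #{b | Q i j a b} = 2)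
    (hcross : ∀ i j k a b, i ≠ j → i ≠ k → j ≠ k → ∃ c, Q i k a c ∧ Q j k b c)
    (hsame : ∀ i j k a a', i ≠ j → i ≠ k → j ≠ k → a ≠ a' →
      (∃ c, Q i j a c ∧ Q i j a' c) ∨ ∃ c, Q i k a c ∧ Q i k a' c) : False := by
  have hin : ∀ i j b, i ≠ j → #{a | Q i j a b} = 2 := by
    intro i j b hij
    have h1 := hdeg j i b hij.symm
    have h2 := Finset.card_filter_add_card_filter_not (s := (univ : Finset (Fin 4)))
      (fun a => Q j i b a)
    rw [Finset.filter_congr fun a _ => hQ i j a b hij]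
    simp at h2
    omega
  -- For fixed `a`, summing over `b` counts 2 · 2 = 4 incidences; each of the four terms is at least
  -- 1.
  have hone : ∀ i j k a b, i ≠ j → i ≠ k → j ≠ k →
      #(({c | Q i k a c} : Finset (Fin 4)) ∩ ({c | Q j k b c} : Finset (Fin 4))) = 1 := by
    intro i j k a b hij hik hjk
    have hpos : ∀ b,
        1 ≤ #(({c | Q i k a c} : Finset (Fin 4)) ∩ ({c | Q j k b c} : Finset (Fin 4))) := by
      intro b
      obtain ⟨c, hc⟩ := hcross i j k a b hij hik hjk
      exact Finset.card_pos.2 ⟨c, by simpa using hc⟩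
    have hsum : ∑ b, #(({c | Q i k a c} : Finset (Fin 4)) ∩ ({c | Q j k b c} : Finset (Fin 4))) =
        ∑ _b : Fin 4, 1 := by
      calc ∑ b, #(({c | Q i k a c} : Finset (Fin 4)) ∩ ({c | Q j k b c} : Finset (Fin 4)))
          = ∑ b, ∑ c ∈ ({c | Q i k a c} : Finset (Fin 4)), if Q j k b c then 1 else 0 := by
            refine Finset.sum_congr rfl fun b _ => ?_
            rw [← Finset.card_filter, ← Finset.filter_and, Finset.filter_filter]
        _ = ∑ c ∈ ({c | Q i k a c} : Finset (Fin 4)), #{b | Q j k b c} := by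
            rw [Finset.sum_comm]
            simp
        _ = ∑ _b : Fin 4, 1 := by
            rw [Finset.sum_congr rfl fun c _ => hin j k c hjk]
            simp [hdeg i k a hik]
    exact ((Finset.sum_eq_sum_iff_of_le fun b _ => hpos b).1 hsum.symm b (Finset.mem_univ b)).symm
  have hor : ∀ i j k, i ≠ j → i ≠ k → j ≠ k → IsBlockRel (Q i k) ∨ IsBlockRel (Q j k) := by
    intro i j k hij hik hjk
    by_contra! hne
    simp only [IsBlockRel, not_forall] at hne
    obtain ⟨⟨a, a', c, c', h1, h2, h3, h4⟩, b, b', d, d', h5, h6, h7, h8⟩ := hne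
    have := Fin.subset_of_card_inter_eq_one (hdeg i k a hik) (hdeg i k a' hik) (hdeg j k b hjk)
      (hdeg j k b' hjk) (hone i j k a b hij hik hjk) (hone i j k a b' hij hik hjk)
      (hone i j k a' b hij hik hjk) (hone i j k a' b' hij hik hjk) ⟨c, by simp [h1, h2]⟩
      (fun hs => h4 (by simpa using @hs c' (by simpa using h3))) ⟨d, by simp [h5, h6]⟩
    exact h8 (by simpa using @this d' (by simpa using h7))
  have hsymm : ∀ i j, i ≠ j → IsBlockRel (Q i j) → IsBlockRel (Q j i) := by
    intro i j hij hS b b' a a' h1 h2 h3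
    rw [hQ j i _ _ hij.symm] at h1 h2 h3 ⊢
    intro h4
    obtain ⟨e, he⟩ := Fin.inter_nonempty_of_notMem (hdeg i j a hij) (hdeg i j a' hij) (b := b)
      (by simpa using h1) (by simpa using h3)
    simp only [Finset.mem_inter, Finset.mem_filter, Finset.mem_univ, true_and] at he
    exact h2 (hS a' a e b' he.2 he.1 h4)
  -- Each vertex of part `i` shares an out-neighbor with `0`, so by the block property it dominates
  -- `c` or `d`. These have two in-neighbors each in part `i`, both including `0`, so they cover at
  -- most three of the four vertices.
  have hnot : ∀ i j k, i ≠ j → i ≠ k → j ≠ k → ¬ (IsBlockRel (Q i j) ∧ IsBlockRel (Q i k)) := by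
    rintro i j k hij hik hjk ⟨hj, hk⟩
    obtain ⟨c, hc⟩ : ({c | Q i j 0 c} : Finset (Fin 4)).Nonempty :=
      Finset.card_pos.1 (by rw [hdeg i j 0 hij]; norm_num)
    obtain ⟨d, hd⟩ : ({d | Q i k 0 d} : Finset (Fin 4)).Nonempty :=
      Finset.card_pos.1 (by rw [hdeg i k 0 hik]; norm_num)
    simp only [Finset.mem_filter, Finset.mem_univ, true_and] at hc hd
    have hunion : ({a | Q i j a c} : Finset (Fin 4)) ∪ ({a | Q i k a d} : Finset (Fin 4)) =
        univ := by
      ext a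
      simp only [Finset.mem_union, Finset.mem_filter, Finset.mem_univ, true_and, iff_true]
      by_cases ha : 0 = a
      · subst ha; exact Or.inl hc
      · rcases hsame i j k 0 a hij hik hjk ha with ⟨e, he, he'⟩ | ⟨e, he, he'⟩
        · exact Or.inl (hj 0 a e c he he' hc)
        · exact Or.inr (hk 0 a e d he he' hd)
    have h1 := Finset.card_union_add_card_inter ({a | Q i j a c} : Finset (Fin 4))
      ({a | Q i k a d} : Finset (Fin 4))
    have h2 : 0 < #(({a | Q i j a c} : Finset (Fin 4)) ∩ ({a | Q i k a d} : Finset (Fin 4))) :=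
      Finset.card_pos.2 ⟨0, by simp [hc, hd]⟩
    rw [hunion, hin i j c hij, hin i k d hik, Finset.card_univ, Fintype.card_fin] at h1
    omega
  -- By `hsymm` the block property belongs to unordered pairs of parts. By `hor` at least two of the
  -- three pairs have it, yet any two share a part, against `hnot`.
  have a1 := hor 0 1 2 (by decide) (by decide) (by decide)
  have a2 := hor 0 2 1 (by decide) (by decide) (by decide)
  have a3 := hor 1 2 0 (by decide) (by decide) (by decide)
  have b1 := hnot 0 1 2 (by decide) (by decide) (by decide)
  have b2 := hnot 1 0 2 (by decide) (by decide) (by decide)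
  have b3 := hnot 2 0 1 (by decide) (by decide) (by decide)
  have c1 := hsymm 0 1 (by decide)
  have c2 := hsymm 1 0 (by decide)
  have c3 := hsymm 0 2 (by decide)
  have c4 := hsymm 2 0 (by decide)
  have c5 := hsymm 1 2 (by decide)
  have c6 := hsymm 2 1 (by decide)
  clear hor hsymm hnot hone hsame hcross hdeg hin hQ
  grind

end Tripartite

/-! ### Reduction of twelve vertices in three parts to the balanced case -/

namespace IsCompetitive

open Classical in
/-- The number of out-neighbors of a vertex in a given partite set. -/
noncomputable def outdegIn {V ι : Type*} [Fintype V] (R : V → V → Prop) (p : V → ι) (u : V)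
    (j : ι) : ℕ :=
  #{v | R u v ∧ p v = j}

variable {V : Type*} [Fintype V] {R : V → V → Prop} {p : V → Fin 3}

theorem _root_.Fin.eq_of_ne_of_ne {i j k l : Fin 3} (hij : i ≠ j) (hki : k ≠ i) (hkj : k ≠ j)
    (hli : l ≠ i) (hlj : l ≠ j) : l = k := by
  omega

theorem outdegIn_eq (R : V → V → Prop) (p : V → Fin 3) (u : V) (j : Fin 3)
    [DecidablePred fun v => R u v ∧ p v = j] : outdegIn R p u j = #{v | R u v ∧ p v = j} := by
  unfold outdegIn
  congr

/-- A directed walk `x`, `y`, `z`, `w` inside the out-neighborhood of `u` alternates between the two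
other parts. -/
theorem two_le_outdegIn (h : IsCompetitive R p) {u : V} {j : Fin 3} (hj : p u ≠ j) :
    2 ≤ outdegIn R p u j := by
  classical
  obtain ⟨x, y, z, hx, hy, hz, hxy, hyz, hxz⟩ := h.exists_out_path (u := u)
  obtain ⟨w, hw, hzw⟩ := h.exists_out_out hz
  have hyw : y ≠ w := by
    rintro rfl
    exact h.asymm _ _ hyz hzw
  have hpz : p z = p x := Fin.eq_of_ne_of_ne (h.part_ne hy) (h.part_ne hx).symm (h.part_ne hxy)
    (h.part_ne hz).symm (h.part_ne hyz).symm
  have hpw : p w = p y := Fin.eq_of_ne_of_ne (h.part_ne hz) (h.part_ne hy).symm (h.part_ne hyz)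
    (h.part_ne hw).symm (h.part_ne hzw).symm
  have key : ∀ {v w}, v ≠ w → R u v → R u w → p v = j → p w = j → 2 ≤ outdegIn R p u j := by
    intro v w hvw hv hw hpv hpw
    rw [← Finset.card_pair hvw]
    refine Finset.card_le_card fun t ht => ?_
    rcases Finset.mem_insert.1 ht with rfl | ht
    · simp [hv, hpv]
    · rw [Finset.mem_singleton] at ht
      simp [ht, hw, hpw]
  by_cases hjx : p x = j
  · exact key hxz hx hz hjx (hpz.trans hjx)
  · have hjy : p y = j := (Fin.eq_of_ne_of_ne (h.part_ne hx) (h.part_ne hy).symm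
      (h.part_ne hxy).symm hj.symm (Ne.symm hjx)).symm
    exact key hyw hy hw hjy (hpw.trans hjy)

open Classical in
theorem sum_outdegIn_add_sum_outdegIn (h : IsCompetitive R p) {i j : Fin 3} (hij : i ≠ j) :
    ∑ u with p u = i, outdegIn R p u j + ∑ v with p v = j, outdegIn R p v i =
      size p i * size p j := by
  have h1 : ∑ u with p u = i, outdegIn R p u j =
      ∑ u with p u = i, ∑ v with p v = j, if R u v then 1 else 0 := by
    refine Finset.sum_congr rfl fun u _ => ?_
    rw [← Finset.card_filter, Finset.filter_filter, outdegIn_eq]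
    simp only [and_comm]
  have h2 : ∑ v with p v = j, outdegIn R p v i =
      ∑ u with p u = i, ∑ v with p v = j, if R v u then 1 else 0 := by
    rw [Finset.sum_comm]
    refine Finset.sum_congr rfl fun u _ => ?_
    rw [← Finset.card_filter, Finset.filter_filter, outdegIn_eq]
    simp only [and_comm]
  rw [h1, h2, ← Finset.sum_add_distrib]
  have h3 : ∀ u ∈ ({u | p u = i} : Finset V),
      (∑ v with p v = j, if R u v then 1 else 0) + (∑ v with p v = j, if R v u then 1 else 0) =
        size p j := by
    intro u hu
    rw [← Finset.sum_add_distrib, size_eq, Finset.card_eq_sum_ones]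
    refine Finset.sum_congr rfl fun v hv => ?_
    simp only [Finset.mem_filter, Finset.mem_univ, true_and] at hu hv
    have ha := h.asymm u v
    have hb := (h.adj_iff u v).2 (by rw [hu, hv]; exact hij)
    by_cases h1 : R u v <;> by_cases h2 : R v u <;> simp_all
  rw [Finset.sum_congr rfl h3, Finset.sum_const, smul_eq_mul, ← size_eq]

theorem card_ne_twelve (h : IsCompetitive R p) : Fintype.card V ≠ 12 := by
  classical
  intro hV
  have hsum : ∀ i j, i ≠ j → 2 * size p i ≤ ∑ u with p u = i, outdegIn R p u j := by
    intro i j hij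
    rw [size_eq, mul_comm, ← smul_eq_mul, ← Finset.sum_const]
    refine Finset.sum_le_sum fun u hu => h.two_le_outdegIn ?_
    simp only [Finset.mem_filter] at hu
    rwa [hu.2]
  have hmul : ∀ i j, i ≠ j → 2 * size p i + 2 * size p j ≤ size p i * size p j := by
    intro i j hij
    rw [← h.sum_outdegIn_add_sum_outdegIn hij]
    exact Nat.add_le_add (hsum i j hij) (hsum j i hij.symm)
  -- The inequalities read (r - 2)(s - 2) ≥ 4 for each pair of sizes; as the three shifted sizes sum
  -- to 6, all equal 2.
  have hsize : ∀ i, size p i = 4 := by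
    have h0 := sum_size p
    rw [hV, Fin.sum_univ_three] at h0
    have h1 := hmul 0 1 (by decide)
    have h2 := hmul 0 2 (by decide)
    have h3 := hmul 1 2 (by decide)
    have key : size p 0 = 4 ∧ size p 1 = 4 ∧ size p 2 = 4 := by
      generalize size p 0 = r at *
      generalize size p 1 = s at *
      generalize size p 2 = t at *
      have hr : r ≤ 12 := by omega
      have hs : s ≤ 12 := by omega
      clear hmul hsum
      interval_cases r <;> interval_cases s <;> omega
    intro i
    fin_cases i
    exacts [key.1, key.2.1, key.2.2]
  have htwo : ∀ u j, p u ≠ j → outdegIn R p u j = 2 := by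
    intro u j hj
    have e := h.sum_outdegIn_add_sum_outdegIn hj
    have e1 := hsum _ _ hj
    have e2 := hsum _ _ hj.symm
    simp only [hsize] at e e1 e2
    have e3 : ∑ v with p v = p u, 2 = ∑ v with p v = p u, outdegIn R p v j := by
      have := hsize (p u)
      rw [size_eq] at this
      rw [Finset.sum_const, this]
      simp only [smul_eq_mul]
      omega
    refine ((Finset.sum_eq_sum_iff_of_le fun v hv => ?_).1 e3 u (by simp)).symm
    apply h.two_le_outdegIn
    simp only [Finset.mem_filter] at hv
    rwa [hv.2]
  have hcard : ∀ i, Fintype.card {v // p v = i} = 4 := fun i => by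
    rw [Fintype.card_subtype, ← size_eq, hsize]
  let e : ∀ i, Fin 4 ≃ {v // p v = i} := fun i => (Fintype.equivFinOfCardEq (hcard i)).symm
  have hp : ∀ i a, p (e i a) = i := fun i a => (e i a).2
  have hsurj : ∀ v, ∃ a, (e (p v) a : V) = v := fun v =>
    ⟨(e (p v)).symm ⟨v, rfl⟩, by simp⟩
  refine not_exists_balanced_tripartite (fun i j a b => R (e i a) (e j b)) ?_ ?_ ?_ ?_
  · intro i j a b hij
    have h1 := h.asymm (e i a) (e j b)
    have h2 := (h.adj_iff (e i a) (e j b)).2 (by rwa [hp, hp])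
    tauto
  · intro i j a hij
    rw [← htwo (e i a) j (by rwa [hp]), outdegIn_eq]
    refine Finset.card_bij (fun b _ => (e j b : V)) ?_ ?_ ?_
    · intro b hb
      simpa [hp] using hb
    · intro b _ b' _ hb
      exact (e j).injective (Subtype.ext hb)
    · intro v hv
      simp only [Finset.mem_filter, Finset.mem_univ, true_and] at hv
      obtain ⟨hv, rfl⟩ := hv
      obtain ⟨b, hb⟩ := hsurj v
      exact ⟨b, by simpa [hb] using hv, hb⟩
  · intro i j k a b hij hik hjk
    obtain ⟨w, hw, hw'⟩ := h.common (e i a) (e j b) (fun he => hij (by rw [← hp i a, he, hp]))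
    have hk : p w = k := Fin.eq_of_ne_of_ne hij hik.symm hjk.symm
      (by rw [← hp i a]; exact (h.part_ne hw).symm) (by rw [← hp j b]; exact (h.part_ne hw').symm)
    subst hk
    obtain ⟨c, hc⟩ := hsurj w
    exact ⟨c, by rw [hc]; exact ⟨hw, hw'⟩⟩
  · intro i j k a a' hij hik hjk ha
    obtain ⟨w, hw, hw'⟩ := h.common (e i a) (e i a')
      (fun he => ha ((e i).injective (Subtype.ext he)))
    have hi : p w ≠ i := by
      rw [← hp i a]
      exact (h.part_ne hw).symm
    obtain ⟨c, hc⟩ := hsurj w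
    rw [← hc] at hw hw'
    by_cases hj : p w = j
    · subst hj
      exact Or.inl ⟨c, hw, hw'⟩
    · have hk : p w = k := Fin.eq_of_ne_of_ne hij hik.symm hjk.symm hi hj
      subst hk
      exact Or.inr ⟨c, hw, hw'⟩

end IsCompetitive

theorem mainTheorem5 (k : ℕ) (hk : 3 ≤ k) (n : ℕ) :
    (∃ D : Digraph (Fin n), IsPartiteTournament k D ∧
        competitionGraph D = SimpleGraph.completeGraph (Fin n)) ↔
      ((k = 3 ∧ 13 ≤ n) ∨ (k = 4 ∧ 10 ≤ n) ∨ (k = 5 ∧ 9 ≤ n) ∨ (k = 6 ∧ 9 ≤ n) ∨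
        (7 ≤ k ∧ k ≤ n)) := by
  rw [exists_digraph_iff_exists_isCompetitive]
  have : Nontrivial (Fin k) := Fin.nontrivial_iff_two_le.2 (by omega)
  constructor
  · intro H
    by_cases h7 : 7 ≤ k
    · obtain ⟨R, p, h⟩ := H
      have := Fintype.card_le_of_surjective p h.surj
      simp only [Fintype.card_fin] at this
      omega
    obtain rfl | rfl | hk' : k = 3 ∨ k = 4 ∨ k = 5 ∨ k = 6 := by omega
    · have : 13 ≤ n := by
        by_contra! hn
        obtain ⟨R, p, h⟩ := exists_isCompetitive_mono (n := 12) (by omega) (by omega) H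
        exact h.card_ne_twelve (by simp)
      omega
    · have : 10 ≤ n := by
        by_contra! hn
        obtain ⟨R, p, h⟩ := exists_isCompetitive_mono (n := 9) (by omega) (by omega) H
        exact h.card_ne_nine (by simp)
      omega
    · have : 9 ≤ n := by
        by_contra! hn
        obtain ⟨R, p, h⟩ := exists_isCompetitive_mono (n := 8) (by omega) (by omega) H
        exact h.card_ne_eight (by simp; omega) (by simp)
      omega
  · rintro (⟨rfl, hn⟩ | ⟨rfl, hn⟩ | ⟨rfl, hn⟩ | ⟨rfl, hn⟩ | ⟨h7, hn⟩)
    · exact exists_isCompetitive_mono (by omega) hn exists_isCompetitive_three_thirteen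
    · exact exists_isCompetitive_mono (by omega) hn exists_isCompetitive_four_ten
    · exact exists_isCompetitive_mono (by omega) hn exists_isCompetitive_five_nine
    · exact exists_isCompetitive_mono (by omega) hn exists_isCompetitive_six_nine
    · exact exists_isCompetitive_mono (by omega) hn (exists_isCompetitive_self h7)
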